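/- Let $G$ be an infinite, connected, locally finite graph with vertex set $V$, and let $\operatorname{Aut} G$ carry the permutation topology, i.e. the topology of pointwise convergence on $V$ with $V$ discrete; it is a locally compact group. The stabiliser of a $2$-colouring $c\colon V\to\{0,1\}$ is the subgroup $(\operatorname{Aut} G)_c=\{\varphi\in\operatorname{Aut} G : c\circ\varphi=c\}$. Suppose that $G$ has infinite motion, i.e. every nontrivial automorphism of $G$ moves infinitely many vertices. Then there is a $2$-colouring $c$ of $V$ such that 1. $(\operatorname{Aut} G)_c$ is a compact subgroup of $\operatorname{Aut} G$; 2. the set $(\operatorname{Aut} G)_c\setminus\{\mathrm{id}\}$ of nontrivial automorphisms preserving $c$ is nowhere dense in $\operatorname{Aut} G$ and has Haar measure zero (so $c$ is distinguishing, i.e. $(\operatorname{Aut} G)_c=\{\mathrm{id}\}$, if $\operatorname{Aut} G$ is discrete); 3. if $\operatorname{Aut} G$ is not discrete, then the subgroup $(\operatorname{Aut} G)_c$ itself is nowhere dense in $\operatorname{Aut} G$ and has Haar measure zero. -/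

import Mathlib

open Set Topology MeasureTheory

namespace SimpleGraph

variable {V : Type*} (G : SimpleGraph V)

/-- The permutation topology on `Aut G`: the topology of pointwise convergence, where the vertex set
carries the discrete topology. -/
instance autTopologicalSpace : TopologicalSpace (G ≃g G) :=
  TopologicalSpace.induced (fun (φ : G ≃g G) (v : V) => φ v)
    (@Pi.topologicalSpace V (fun _ => V) (fun _ => ⊥))

/-- The motion of an automorphism: the number of vertices which are not fixed by it. -/
noncomputable def autMotion (φ : G ≃g G) : ℕ∞ := {v : V | φ v ≠ v}.encard

/-- The motion of a graph: the minimal motion of a nontrivial automorphism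
(`⊤` if there is no nontrivial automorphism). -/
noncomputable def motion : ℕ∞ := ⨅ (φ : G ≃g G) (_ : φ ≠ 1), G.autMotion φ

/-- `G` has infinite motion: every nontrivial automorphism moves infinitely many vertices. -/
def InfiniteMotion : Prop := G.motion = ⊤

/-- The stabiliser in `Aut G` of a `2`-colouring `c` of the vertices, i.e. the automorphisms `φ` with
`c (φ v) = c v` for all `v`. -/
def colouringStabiliser (c : V → Fin 2) : Subgroup (G ≃g G) where
  carrier := {φ | (fun v => c (φ v)) = c}
  one_mem' := rfl
  mul_mem' := by
    intro a b ha hb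
    funext v
    exact (congrFun ha (b v)).trans (congrFun hb v)
  inv_mem' := by
    intro a ha
    funext v
    have h := congrFun ha (a⁻¹ v)
    have h2 : a (a⁻¹ v) = v := a.apply_symm_apply v
    simp only [h2] at h
    exact h.symm

/-! The permutation topology makes `Aut G` a topological group, which is locally compact if `G` is
connected and locally finite; so Haar measures on it exist. -/

theorem continuous_to_aut {X : Type*} [TopologicalSpace X] {f : X → (G ≃g G)} :
    Continuous f ↔ ∀ v w : V, IsOpen {x | f x v = w} := by
  letI : TopologicalSpace V := ⊥
  haveI : DiscreteTopology V := ⟨rfl⟩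
  rw [continuous_induced_rng, continuous_pi_iff]
  refine forall_congr' fun v => ?_
  rw [continuous_discrete_rng]
  rfl

theorem isOpen_aut_apply_eq (v w : V) : IsOpen {φ : G ≃g G | φ v = w} :=
  (G.continuous_to_aut (f := id)).1 continuous_id v w

instance autIsTopologicalGroup : IsTopologicalGroup (G ≃g G) where
  continuous_mul := by
    rw [continuous_to_aut]
    intro v w
    have : {x : (G ≃g G) × (G ≃g G) | (x.1 * x.2) v = w} =
        ⋃ u : V, {φ : G ≃g G | φ u = w} ×ˢ {φ : G ≃g G | φ v = u} := by
      ext x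
      simp [RelIso.mul_apply]
    rw [this]
    exact isOpen_iUnion fun u => (G.isOpen_aut_apply_eq u w).prod (G.isOpen_aut_apply_eq v u)
  continuous_inv := by
    rw [continuous_to_aut]
    intro v w
    have : {φ : G ≃g G | φ⁻¹ v = w} = {φ : G ≃g G | φ w = v} := by
      ext φ
      exact ⟨fun h => by rw [← h.out]; exact φ.apply_symm_apply v,
        fun h => by rw [← h.out]; exact φ.symm_apply_apply w⟩
    rw [this]
    exact G.isOpen_aut_apply_eq w v

theorem finite_dist_le [G.LocallyFinite] (hG : G.Connected) (v₀ : V) (n : ℕ) :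
    {v : V | G.dist v₀ v ≤ n}.Finite := by
  induction n with
  | zero =>
    refine (Set.finite_singleton v₀).subset fun v hv => ?_
    have h : G.dist v₀ v = 0 := Nat.le_zero.1 hv
    exact ((hG.dist_eq_zero_iff).1 h).symm
  | succ n ih =>
    refine (ih.union (ih.biUnion fun u _ => (G.neighborSet u).toFinite)).subset fun v hv => ?_
    by_cases h : G.dist v₀ v ≤ n
    · exact Or.inl h
    · right
      obtain ⟨p, hp⟩ := hG.exists_walk_length_eq_dist v v₀
      cases p with
      | nil => simp at h
      | @cons _ u _ hvu q =>
        refine Set.mem_biUnion (x := u) ?_ hvu.symm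
        have h1 := G.dist_le q
        rw [Walk.length_cons, G.dist_comm] at hp
        have h2 : G.dist v₀ v ≤ n + 1 := hv
        change G.dist v₀ u ≤ n
        rw [G.dist_comm]
        omega

theorem dist_aut (hG : G.Connected) (φ : G ≃g G) (u v : V) : G.dist (φ u) (φ v) = G.dist u v := by
  have key : ∀ (ψ : G ≃g G) (x y : V), G.dist (ψ x) (ψ y) ≤ G.dist x y := by
    intro ψ x y
    obtain ⟨p, hp⟩ := hG.exists_walk_length_eq_dist x y
    have := G.dist_le (p.map ψ.toHom)
    rw [Walk.length_map, hp] at this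
    exact this
  refine le_antisymm (key φ u v) ?_
  have := key φ.symm (φ u) (φ v)
  rwa [φ.symm_apply_apply, φ.symm_apply_apply] at this

theorem isCompact_aut_stabiliser [G.LocallyFinite] (hG : G.Connected) (v₀ : V) :
    IsCompact {φ : G ≃g G | φ v₀ = v₀} := by
  letI : TopologicalSpace V := ⊥
  haveI : DiscreteTopology V := ⟨rfl⟩
  let B : V → Set V := fun v => {w | G.dist v₀ w ≤ G.dist v₀ v}
  have hB : IsCompact (Set.pi univ B) :=
    isCompact_univ_pi fun v => (G.finite_dist_le hG v₀ _).isCompact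
  let K : Set ((V → V) × (V → V)) := {x | (∀ v, x.1 (x.2 v) = v) ∧ (∀ v, x.2 (x.1 v) = v) ∧
    (∀ v w, G.Adj (x.1 v) (x.1 w) ↔ G.Adj v w) ∧ x.1 v₀ = v₀}
  have ev1 : ∀ v : V, Continuous fun x : (V → V) × (V → V) => x.1 v := fun v =>
    (continuous_apply v).comp continuous_fst
  have ev2 : ∀ v : V, Continuous fun x : (V → V) × (V → V) => x.2 v := fun v =>
    (continuous_apply v).comp continuous_snd
  have evc : ∀ v : V, Continuous fun x : (V → V) × (V → V) => x.1 (x.2 v) := by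
    intro v
    rw [continuous_discrete_rng]
    intro w
    have : (fun x : (V → V) × (V → V) => x.1 (x.2 v)) ⁻¹' {w} =
        ⋃ u, ((fun x => x.2 v) ⁻¹' {u} ∩ (fun x => x.1 u) ⁻¹' {w}) := by
      ext x; simp
    rw [this]
    exact isOpen_iUnion fun u => ((isOpen_discrete _).preimage (ev2 v)).inter
      ((isOpen_discrete _).preimage (ev1 u))
  have evd : ∀ v : V, Continuous fun x : (V → V) × (V → V) => x.2 (x.1 v) := by
    intro v
    exact (evc v).comp continuous_swap
  have hK : IsClosed K := by
    have c1 : IsClosed {x : (V → V) × (V → V) | ∀ v, x.1 (x.2 v) = v} := by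
      rw [setOf_forall]
      exact isClosed_iInter fun v => (isClosed_discrete {v}).preimage (evc v)
    have c2 : IsClosed {x : (V → V) × (V → V) | ∀ v, x.2 (x.1 v) = v} := by
      rw [setOf_forall]
      exact isClosed_iInter fun v => (isClosed_discrete {v}).preimage (evd v)
    have c3 : IsClosed {x : (V → V) × (V → V) | ∀ v w, G.Adj (x.1 v) (x.1 w) ↔ G.Adj v w} := by
      simp only [setOf_forall]
      exact isClosed_iInter fun v => isClosed_iInter fun w =>
        (isClosed_discrete {y : V × V | G.Adj y.1 y.2 ↔ G.Adj v w}).preimage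
          ((ev1 v).prodMk (ev1 w))
    have c4 : IsClosed {x : (V → V) × (V → V) | x.1 v₀ = v₀} :=
      (isClosed_discrete {v₀}).preimage (ev1 v₀)
    exact c1.inter (c2.inter (c3.inter c4))
  have hKc : IsCompact (((Set.pi univ B) ×ˢ (Set.pi univ B)) ∩ K) := (hB.prod hB).inter_right hK
  rw [isCompact_iff_compactSpace] at hKc
  let f : ↥(((Set.pi univ B) ×ˢ (Set.pi univ B)) ∩ K) → (G ≃g G) := fun x =>
    { toFun := x.1.1
      invFun := x.1.2
      left_inv := x.2.2.2.1
      right_inv := x.2.2.1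
      map_rel_iff' := x.2.2.2.2.1 _ _ }
  have hf : Continuous f := by
    rw [continuous_to_aut]
    intro v w
    exact (isOpen_discrete {w}).preimage ((ev1 v).comp continuous_subtype_val)
  have : {φ : G ≃g G | φ v₀ = v₀} = range f := by
    ext φ
    constructor
    · intro hφ
      have hφ : φ v₀ = v₀ := hφ
      have hφ' : φ.symm v₀ = v₀ := by
        conv_lhs => rw [← hφ]
        exact φ.symm_apply_apply v₀
      refine ⟨⟨(φ, φ.symm), ⟨⟨fun v _ => ?_, fun v _ => ?_⟩, φ.apply_symm_apply,
        φ.symm_apply_apply, fun v w => φ.map_adj_iff, hφ⟩⟩, ?_⟩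
      · have := G.dist_aut hG φ v₀ v
        rw [hφ] at this
        exact this.le
      · have := G.dist_aut hG φ.symm v₀ v
        rw [hφ'] at this
        exact this.le
      · ext v
        rfl
    · rintro ⟨x, rfl⟩
      exact x.2.2.2.2.2
  rw [this]
  exact isCompact_range hf

theorem aut_locallyCompactSpace [G.LocallyFinite] (hG : G.Connected) :
    LocallyCompactSpace (G ≃g G) := by
  obtain ⟨v₀⟩ := hG.nonempty
  exact (G.isCompact_aut_stabiliser hG v₀).locallyCompactSpace_of_mem_nhds_of_group (x := 1)
    ((G.isOpen_aut_apply_eq v₀ v₀).mem_nhds rfl)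

end SimpleGraph

namespace SimpleGraph

variable {V : Type*} (G : SimpleGraph V)

/-! `Aut G` is second countable, so its nontrivial elements have a countable dense sequence `φ n`.
Infinite motion gives vertices `x n` moved by `φ n`, so sparse that `φ n (x n)` avoids `X = {v₀} ∪
{x m}`; colouring by membership in `X` breaks every `φ n`. As `v₀`, `x 0` is the unique closest pair
in `X`, the stabiliser moves `v₀` to only two places, hence is compact. By density its interior lies
in `{1}`, and a compact subgroup of positive Haar measure is open, so it must then be trivial and
`Aut G` discrete. -/

theorem countable_of_locallyFinite [G.LocallyFinite] (hG : G.Connected) : Countable V := by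
  obtain ⟨v₀⟩ := hG.nonempty
  have h : (⋃ n : ℕ, {v : V | G.dist v₀ v ≤ n}) = univ :=
    eq_univ_of_forall fun v => mem_iUnion.2 ⟨G.dist v₀ v, le_refl (G.dist v₀ v)⟩
  rw [← countable_univ_iff, ← h]
  exact countable_iUnion fun n => (G.finite_dist_le hG v₀ n).countable

theorem aut_secondCountableTopology [Countable V] : SecondCountableTopology (G ≃g G) := by
  let : TopologicalSpace V := ⊥
  have : DiscreteTopology V := ⟨rfl⟩
  exact TopologicalSpace.secondCountableTopology_induced (G ≃g G) (V → V) fun φ v => φ v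

theorem aut_t2Space : T2Space (G ≃g G) := by
  let : TopologicalSpace V := ⊥
  have : DiscreteTopology V := ⟨rfl⟩
  have hc : Continuous fun (φ : G ≃g G) (v : V) => φ v := continuous_induced_dom
  exact T2Space.of_injective_continuous (fun φ ψ h => RelIso.ext (congrFun h)) hc

theorem isClosed_colouringStabiliser (c : V → Fin 2) :
    IsClosed (G.colouringStabiliser c : Set (G ≃g G)) := by
  have h : (G.colouringStabiliser c : Set (G ≃g G)) =
      ⋂ v : V, (⋃ w ∈ {w : V | c w ≠ c v}, {φ : G ≃g G | φ v = w})ᶜ := by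
    ext φ
    have : φ ∈ G.colouringStabiliser c ↔ ∀ v, c (φ v) = c v := funext_iff
    simp only [SetLike.mem_coe, this, mem_iInter, mem_compl_iff, mem_iUnion, not_exists]
    exact ⟨fun h v w hw hφ => hw (hφ ▸ h v), fun h v => by_contra fun hv => h v _ hv rfl⟩
  rw [h]
  exact isClosed_iInter fun v =>
    (isOpen_biUnion fun w _ => G.isOpen_aut_apply_eq v w).isClosed_compl

/-- The set is empty or a left coset of the compact stabiliser of `v`. -/
theorem isCompact_aut_apply_eq [G.LocallyFinite] (hG : G.Connected) (v w : V) :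
    IsCompact {φ : G ≃g G | φ v = w} := by
  by_cases h : ∃ ψ : G ≃g G, ψ v = w
  · obtain ⟨ψ, rfl⟩ := h
    convert (G.isCompact_aut_stabiliser hG v).image (continuous_const_mul ψ) using 1
    ext φ
    constructor
    · intro hφ
      have hφ : φ v = ψ v := hφ
      refine ⟨ψ⁻¹ * φ, ?_, mul_inv_cancel_left ψ φ⟩
      change ψ.symm (φ v) = v
      rw [hφ, ψ.symm_apply_apply]
    · rintro ⟨χ, hχ, rfl⟩
      exact congrArg ψ hχ
  · convert isCompact_empty (X := G ≃g G)
    ext φ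
    exact ⟨fun hφ => h ⟨φ, hφ⟩, False.elim⟩

/-! ### Breaking countably many automorphisms -/

theorem InfiniteMotion.infinite_moved {G : SimpleGraph V} (h : G.InfiniteMotion) {φ : G ≃g G}
    (hφ : φ ≠ 1) : {v : V | φ v ≠ v}.Infinite := by
  rw [← Set.encard_eq_top_iff]
  have h1 : G.motion = ⊤ := h
  exact iInf_eq_top.1 (iInf_eq_top.1 h1 φ) hφ

/-- A nontrivial automorphism moves some vertex far from `v₀` to another such vertex. -/
theorem InfiniteMotion.exists_far_moved {G : SimpleGraph V} [G.LocallyFinite]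
    (h : G.InfiniteMotion) (hG : G.Connected) (v₀ : V) {φ : G ≃g G} (hφ : φ ≠ 1) (R : ℕ) :
    ∃ x, φ x ≠ x ∧ R < G.dist v₀ x ∧ R < G.dist v₀ (φ x) := by
  have hB := G.finite_dist_le hG v₀ R
  obtain ⟨x, hx, hxB⟩ := ((h.infinite_moved hφ).sdiff
    (hB.union (hB.preimage φ.injective.injOn))).nonempty
  simp only [mem_union, mem_ofPred_eq, mem_preimage, not_or, not_le] at hxB
  exact ⟨x, hx, hxB⟩

/-- Vertices `x n` moved by `φ n`, whose distances from `v₀` grow fast. -/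
theorem InfiniteMotion.exists_sparse_seq {G : SimpleGraph V} [G.LocallyFinite]
    (h : G.InfiniteMotion) (hG : G.Connected) (v₀ : V) {φ : ℕ → (G ≃g G)} (hφ : ∀ n, φ n ≠ 1) :
    ∃ x : ℕ → V, (∀ n, φ n (x n) ≠ x n) ∧ (∀ n, x n ≠ v₀) ∧ (∀ n, φ n (x n) ≠ v₀) ∧
      ∀ m n, m < n → 2 * G.dist v₀ (x m) < G.dist v₀ (x n) ∧
        G.dist v₀ (x m) < G.dist v₀ (φ n (x n)) ∧ G.dist v₀ (φ m (x m)) < G.dist v₀ (x n) := by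
  choose g hg1 hg2 hg3 using fun n => h.exists_far_moved hG v₀ (hφ n)
  -- `R n` bounds `2 * dist v₀ (x m)` and `dist v₀ (φ m (x m))` for all `m < n`.
  let R : ℕ → ℕ := fun n => Nat.rec 0 (fun n r =>
    r + 2 * G.dist v₀ (g n r) + G.dist v₀ (φ n (g n r))) n
  have hR : ∀ n, R (n + 1) = R n + 2 * G.dist v₀ (g n (R n)) + G.dist v₀ (φ n (g n (R n))) :=
    fun n => rfl
  have hmono : Monotone R := monotone_nat_of_le_succ fun n => by rw [hR]; omega
  refine ⟨fun n => g n (R n), fun n => hg1 n _, fun n hn => ?_, fun n hn => ?_,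
    fun m n hmn => ?_⟩
  · have h1 := hg2 n (R n)
    dsimp only at hn
    rw [hn, dist_self] at h1
    omega
  · have h1 := hg3 n (R n)
    dsimp only at hn
    rw [hn, dist_self] at h1
    omega
  · have h1 := hmono (Nat.succ_le_of_lt hmn)
    have h2 := hg2 n (R n)
    have h3 := hg3 n (R n)
    have h4 := hR m
    rw [Nat.succ_eq_add_one] at h1
    refine ⟨?_, ?_, ?_⟩ <;> dsimp only <;> omega

open Classical in
/-- Any sequence of nontrivial automorphisms is broken by a colouring with compact stabiliser. -/
theorem InfiniteMotion.exists_colouring_breaking_seq {G : SimpleGraph V} [G.LocallyFinite]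
    (h : G.InfiniteMotion) (hG : G.Connected) {φ : ℕ → (G ≃g G)} (hφ : ∀ n, φ n ≠ 1) :
    ∃ c : V → Fin 2, IsCompact (G.colouringStabiliser c : Set (G ≃g G)) ∧
      ∀ n, φ n ∉ G.colouringStabiliser c := by
  obtain ⟨v₀⟩ := hG.nonempty
  obtain ⟨x, hx1, hx2, hx3, hx4⟩ := h.exists_sparse_seq hG v₀ hφ
  let X : Set V := insert v₀ (range x)
  let c : V → Fin 2 := fun v => if v ∈ X then 1 else 0
  have hc : ∀ {ψ : G ≃g G}, ψ ∈ G.colouringStabiliser c → ∀ v ∈ X, ψ v ∈ X := by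
    intro ψ hψ v hv
    have h1 : c (ψ v) = c v := congrFun hψ v
    by_contra h2
    simp [c, hv, h2] at h1
  -- The factor `2` in the growth condition is needed here, via the triangle inequality.
  have hsep : ∀ m n, m < n → G.dist v₀ (x m) < G.dist (x m) (x n) := by
    intro m n hmn
    have h1 := (hx4 m n hmn).1
    have h2 := hG.dist_triangle (u := v₀) (v := x m) (w := x n)
    omega
  have hle : ∀ n, G.dist v₀ (x 0) ≤ G.dist v₀ (x n) := by
    intro n
    rcases n.eq_zero_or_pos with rfl | hn
    · exact le_rfl
    · have := (hx4 0 n hn).1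
      omega
  -- `v₀` and `x 0` are the closest two vertices of `X`
  have hclose : ∀ y ∈ X, ∀ z ∈ X, y ≠ z → G.dist y z = G.dist v₀ (x 0) → y = v₀ ∨ y = x 0 := by
    rintro y (rfl | ⟨m, rfl⟩) z (rfl | ⟨n, rfl⟩) hyz hd
    · exact Or.inl rfl
    · exact Or.inl rfl
    · rcases m.eq_zero_or_pos with rfl | hm
      · exact Or.inr rfl
      · have := (hx4 0 m hm).1
        rw [G.dist_comm] at hd
        omega
    · rcases lt_trichotomy m n with hmn | rfl | hmn
      · have := hsep m n hmn
        have := hle m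
        omega
      · exact absurd rfl hyz
      · have := hsep n m hmn
        have := hle n
        rw [G.dist_comm] at hd
        omega
  have hv₀ : v₀ ∈ X := mem_insert _ _
  have hxX : ∀ n, x n ∈ X := fun n => mem_insert_of_mem _ (mem_range_self n)
  refine ⟨c, ?_, fun n hn => ?_⟩
  · refine ((G.isCompact_aut_apply_eq hG v₀ v₀).union
      (G.isCompact_aut_apply_eq hG v₀ (x 0))).of_isClosed_subset
      (G.isClosed_colouringStabiliser c) fun ψ hψ => ?_
    exact hclose _ (hc hψ _ hv₀) _ (hc hψ _ (hxX 0)) (fun he => hx2 0 (ψ.injective he).symm)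
      (G.dist_aut hG ψ _ _)
  -- Comparing distances from `v₀` shows that `φ n (x n)` is no point of `X`.
  · rcases hc hn _ (hxX n) with h1 | ⟨m, h1⟩
    · exact hx3 n h1
    · rcases lt_trichotomy m n with hmn | rfl | hmn
      · have := (hx4 m n hmn).2.1
        rw [h1] at this
        omega
      · exact hx1 m h1.symm
      · have := (hx4 n m hmn).2.2
        rw [h1] at this
        omega

theorem InfiniteMotion.exists_colouring_interior_subset {G : SimpleGraph V} [G.LocallyFinite]
    (h : G.InfiniteMotion) (hG : G.Connected) :
    ∃ c : V → Fin 2, IsCompact (G.colouringStabiliser c : Set (G ≃g G)) ∧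
      interior (G.colouringStabiliser c : Set (G ≃g G)) ⊆ {1} := by
  have := G.countable_of_locallyFinite hG
  have := G.aut_secondCountableTopology
  have := G.aut_t2Space
  rcases isEmpty_or_nonempty ({1}ᶜ : Set (G ≃g G)) with hA | hA
  · have h1 : ∀ φ : G ≃g G, φ = 1 := fun φ => by_contra fun hφ => hA.false ⟨φ, hφ⟩
    exact ⟨fun _ => 0, ((finite_singleton 1).subset fun φ _ => h1 φ).isCompact, fun φ _ => h1 φ⟩
  · let d := TopologicalSpace.denseSeq ({1}ᶜ : Set (G ≃g G))
    obtain ⟨c, hc1, hc2⟩ := h.exists_colouring_breaking_seq hG fun n => (d n).2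
    -- A nontrivial interior point would put some `d n` in the stabiliser.
    refine ⟨c, hc1, fun φ hφ => by_contra fun hφ1 => ?_⟩
    obtain ⟨n, hn⟩ := (TopologicalSpace.denseRange_denseSeq ({1}ᶜ : Set (G ≃g G))).exists_mem_open
      (isOpen_interior.preimage continuous_subtype_val) ⟨⟨φ, hφ1⟩, hφ⟩
    exact hc2 n (interior_subset hn)

end SimpleGraph

/-! ### Closed subgroups with interior in `{1}` -/

theorem Subgroup.isNowhereDense_diff_one {A : Type*} [Group A] [TopologicalSpace A]
    {S : Subgroup A} (hS : IsClosed (S : Set A))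
    (hint : interior (S : Set A) ⊆ {1}) : IsNowhereDense ((S : Set A) \ {1}) := by
  rw [IsNowhereDense, eq_empty_iff_forall_notMem]
  intro a ha
  have hsub : interior (_root_.closure ((S : Set A) \ {1})) ⊆ {1} :=
    (interior_mono (closure_minimal sdiff_subset hS)).trans hint
  -- A nonempty interior of the closure would meet `S \ {1}`, even if `1` is isolated.
  obtain ⟨b, hb, -, hb1⟩ := mem_closure_iff.1 (interior_subset ha) _ isOpen_interior ha
  exact hb1 (hsub hb)

theorem Subgroup.discreteTopology_of_isOpen_of_interior_subset {A : Type*} [Group A]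
    [TopologicalSpace A] [IsTopologicalGroup A] {S : Subgroup A} (hS : IsOpen (S : Set A))
    (hint : interior (S : Set A) ⊆ {1}) : (S : Set A) = {1} ∧ DiscreteTopology A := by
  rw [hS.interior_eq] at hint
  have h1 : (S : Set A) = {1} := hint.antisymm (singleton_subset_iff.2 S.one_mem)
  exact ⟨h1, discreteTopology_of_isOpen_singleton_one (h1 ▸ hS)⟩

/-- A compact subgroup of positive Haar measure is open. -/
theorem Subgroup.isOpen_of_haar_ne_zero {A : Type*} [Group A] [TopologicalSpace A]
    [IsTopologicalGroup A] [T2Space A] [LocallyCompactSpace A] [SecondCountableTopology A]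
    [MeasurableSpace A] [BorelSpace A] (μ : Measure A) [μ.IsHaarMeasure] {S : Subgroup A}
    (hS : IsCompact (S : Set A)) (hpos : μ (S : Set A) ≠ 0) : IsOpen (S : Set A) := by
  let := TopologicalSpace.metrizableSpaceMetric A
  -- Steinhaus: the quotients of a set of positive measure fill a neighbourhood of `1`.
  have h := Measure.div_mem_nhds_one_of_haar_pos μ (S : Set A) hS.measurableSet
    (pos_iff_ne_zero.2 hpos)
  refine S.isOpen_of_mem_nhds (Filter.mem_of_superset h ?_)
  rintro _ ⟨a, ha, b, hb, rfl⟩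
  exact S.div_mem ha hb

theorem mainTheorem8 {V : Type*} [Infinite V] (G : SimpleGraph V) [G.LocallyFinite]
    (hconn : G.Connected) (hmotion : G.InfiniteMotion)
    [MeasurableSpace (G ≃g G)] [BorelSpace (G ≃g G)] :
    ∃ c : V → Fin 2,
      -- the stabiliser of `c` is compact
      IsCompact (G.colouringStabiliser c : Set (G ≃g G)) ∧
      -- its set of nontrivial elements is nowhere dense and of Haar measure zero
      IsNowhereDense ((G.colouringStabiliser c : Set (G ≃g G)) \ {1}) ∧
      (∀ μ : Measure (G ≃g G), μ.IsHaarMeasure →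
        μ ((G.colouringStabiliser c : Set (G ≃g G)) \ {1}) = 0) ∧
      -- if `Aut G` is not discrete, the whole stabiliser is nowhere dense and of Haar measure zero
      (¬ DiscreteTopology (G ≃g G) →
        IsNowhereDense (G.colouringStabiliser c : Set (G ≃g G)) ∧
        ∀ μ : Measure (G ≃g G), μ.IsHaarMeasure →
          μ (G.colouringStabiliser c : Set (G ≃g G)) = 0) := by
  have := G.countable_of_locallyFinite hconn
  have := G.aut_secondCountableTopology
  have := G.aut_t2Space
  have := G.aut_locallyCompactSpace hconn
  obtain ⟨c, hc, hint⟩ := hmotion.exists_colouring_interior_subset hconn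
  have hclosed := G.isClosed_colouringStabiliser c
  refine ⟨c, hc, Subgroup.isNowhereDense_diff_one hclosed hint, fun μ hμ => ?_, fun hd => ⟨?_, ?_⟩⟩
  · by_cases h0 : μ (G.colouringStabiliser c : Set (G ≃g G)) = 0
    · exact measure_mono_null sdiff_subset h0
    · have hopen := Subgroup.isOpen_of_haar_ne_zero μ hc h0
      rw [(Subgroup.discreteTopology_of_isOpen_of_interior_subset hopen hint).1]
      simp
  · rw [hclosed.isNowhereDense_iff, eq_empty_iff_forall_notMem]
    intro φ hφ
    have h1 : φ = 1 := hint hφ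
    subst h1
    exact hd (Subgroup.discreteTopology_of_isOpen_of_interior_subset
      ((G.colouringStabiliser c).isOpen_of_one_mem_interior hφ) hint).2
  · intro μ hμ
    by_contra h0
    exact hd (Subgroup.discreteTopology_of_isOpen_of_interior_subset
      (Subgroup.isOpen_of_haar_ne_zero μ hc h0) hint).2
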